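/- Let $n \ge 3$ and let $F_n$ be the free group with free basis $x_1,\dots,x_n$. Call an element of $F_n$ a palindrome if its reduced word in $x_1^{\pm1},\dots,x_n^{\pm1}$ reads the same backwards as forwards. Let $\Pi A_n \le \mathrm{Aut}(F_n)$ be the palindromic automorphism group, consisting of all automorphisms that map each $x_i$ to a palindrome; let $IA_n \le \mathrm{Aut}(F_n)$ be the subgroup of automorphisms acting trivially on the abelianization of $F_n$; let $PI_n = IA_n \cap \Pi A_n$ be the palindromic Torelli group; and let $E\Pi A_n = \langle \mu_{ij} \mid 1 \le i \ne j \le n\rangle$ be the elementary palindromic automorphism group, where $\mu_{ij}$ is the automorphism with $\mu_{ij}(x_i) = x_j x_i x_j$ and $\mu_{ij}(x_k) = x_k$ for $k \ne i$. Then $$PI_n = IA_n \cap (E\Pi A_n)',$$ where $(E\Pi A_n)'$ denotes the commutator subgroup of $E\Pi A_n$. -/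

import Mathlib

namespace PalindromicAut

/-- The free group of rank `n` with free basis `x i = FreeGroup.of i`. -/
abbrev F (n : ℕ) : Type := FreeGroup (Fin n)

/-- An element of the free group is a palindrome if its reduced word reads the same
backwards as forwards. -/
def IsPalindrome {n : ℕ} (w : F n) : Prop := w.toWord.reverse = w.toWord

/-- The endomorphism of the free group inverting every basis element. -/
def invGens (n : ℕ) : F n →* F n := FreeGroup.lift fun i => (FreeGroup.of i)⁻¹

/-- Word reversal on the free group. -/
def rev {n : ℕ} (w : F n) : F n := (invGens n w)⁻¹

theorem rev_mul {n : ℕ} (u v : F n) : rev (u * v) = rev v * rev u := by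
  simp [rev]

theorem rev_inv {n : ℕ} (u : F n) : rev u⁻¹ = (rev u)⁻¹ := by
  simp [rev]

theorem rev_of {n : ℕ} (i : Fin n) : rev (FreeGroup.of i) = FreeGroup.of i := by
  simp [rev, invGens]

theorem rev_one {n : ℕ} : rev (1 : F n) = 1 := by
  simp [rev]

theorem rev_mk {n : ℕ} (L : List (Fin n × Bool)) :
    rev (FreeGroup.mk L) = FreeGroup.mk L.reverse := by
  induction L with
  | nil => exact rev_one
  | cons a L ih =>
    have h : FreeGroup.mk (a :: L) = FreeGroup.mk [a] * FreeGroup.mk L := rfl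
    have h1 : rev (FreeGroup.mk [a]) = FreeGroup.mk [a] := by
      obtain ⟨i, b⟩ := a
      cases b with
      | true => exact rev_of i
      | false =>
        have h2 : (FreeGroup.mk [(i, false)] : F n) = (FreeGroup.of i)⁻¹ := rfl
        rw [h2, rev_inv, rev_of]
    rw [h, rev_mul, ih, h1, List.reverse_cons, FreeGroup.mul_mk]

theorem toWord_rev {n : ℕ} (w : F n) : (rev w).toWord = w.toWord.reverse := by
  have h : FreeGroup.IsReduced w.toWord.reverse := by
    have h0 : FreeGroup.IsReduced w.toWord := FreeGroup.isReduced_toWord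
    unfold FreeGroup.IsReduced at h0 ⊢
    rw [List.isChain_reverse]
    refine h0.imp ?_
    intro a b hab hba
    exact (hab hba.symm).symm
  conv_lhs => rw [← FreeGroup.mk_toWord (x := w)]
  rw [rev_mk, FreeGroup.toWord_mk]
  exact FreeGroup.isReduced_iff_reduce_eq.mp h

theorem isPalindrome_iff_rev {n : ℕ} (w : F n) : IsPalindrome w ↔ rev w = w := by
  rw [IsPalindrome, ← toWord_rev, FreeGroup.toWord_inj]

theorem map_rev {n : ℕ} (φ : MulAut (F n)) (h : ∀ i, IsPalindrome (φ (FreeGroup.of i)))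
    (w : F n) : φ (rev w) = rev (φ w) := by
  induction w using FreeGroup.induction_on with
  | C1 => simp [rev_one]
  | of i => rw [rev_of, (isPalindrome_iff_rev _).mp (h i)]
  | inv_of i hi => rw [rev_inv, map_inv, map_inv, rev_inv, hi]
  | mul u v hu hv => rw [rev_mul, map_mul, map_mul, rev_mul, hu, hv]

/-- The palindromic automorphism group `ΠA_n`: all automorphisms of the free group that map
each basis element to a palindrome. -/
def PiA (n : ℕ) : Subgroup (MulAut (F n)) where
  carrier := {φ | ∀ i : Fin n, IsPalindrome (φ (FreeGroup.of i))}
  one_mem' := fun i => by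
    rw [isPalindrome_iff_rev]; exact rev_of i
  mul_mem' := by
    intro φ ψ hφ hψ i
    rw [isPalindrome_iff_rev, MulAut.mul_apply, ← map_rev φ hφ,
      (isPalindrome_iff_rev _).mp (hψ i)]
  inv_mem' := by
    intro φ hφ i
    rw [isPalindrome_iff_rev]
    apply φ.injective
    rw [map_rev φ hφ, MulAut.apply_inv_self, rev_of]

/-- The action of automorphisms of a group on its abelianization. -/
def abMap (G : Type*) [Group G] : MulAut G →* MulAut (Abelianization G) where
  toFun φ := φ.abelianizationCongr
  map_one' := abelianizationCongr_refl
  map_mul' φ ψ := (abelianizationCongr_trans ψ φ).symm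

/-- `IA_n`: the automorphisms of the free group acting trivially on its abelianization. -/
def IA (n : ℕ) : Subgroup (MulAut (F n)) := (abMap (F n)).ker

/-- The endomorphism `x_i ↦ c x_i c`, fixing the other basis elements. -/
def muHom {n : ℕ} (i : Fin n) (c : F n) : F n →* F n :=
  FreeGroup.lift fun k => if k = i then c * FreeGroup.of i * c else FreeGroup.of k

/-- The automorphism `μ_{ij}` (for `i ≠ j`): `x_i ↦ x_j x_i x_j`, and `x_k ↦ x_k` for `k ≠ i`. -/
def mu {n : ℕ} (i j : Fin n) (h : i ≠ j) : MulAut (F n) :=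
  MonoidHom.toMulEquiv (muHom i (FreeGroup.of j)) (muHom i (FreeGroup.of j)⁻¹)
    (by
      ext k
      by_cases hk : k = i
      · subst hk; simp [muHom, h.symm, mul_assoc]
      · simp [muHom, hk])
    (by
      ext k
      by_cases hk : k = i
      · subst hk; simp [muHom, h.symm, mul_assoc]
      · simp [muHom, hk])

/-- The elementary palindromic automorphism group `EΠA_n`, generated by all `μ_{ij}`, `i ≠ j`. -/
def EPiA (n : ℕ) : Subgroup (MulAut (F n)) :=
  Subgroup.closure {φ | ∃ (i j : Fin n) (h : i ≠ j), φ = mu i j h}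

/-- The palindromic Torelli group `PI_n = IA_n ∩ ΠA_n`. -/
def PI (n : ℕ) : Subgroup (MulAut (F n)) := IA n ⊓ PiA n

end PalindromicAut

namespace PalindromicAut

open FreeGroup hiding map_mul map_inv map_one norm

/-! The inclusion from right to left holds because every `mu i j h` is palindromic. The other has
two steps.

A Nielsen-type length reduction writes a palindromic `φ` as a signed permutation of the basis times
an element of `EPiA n`. Modulo 4, elements of `EPiA n` act on the abelianization as `1 + 2A` with
zero diagonal in `A`; the only signed permutation of that shape is the identity, so `φ ∈ IA n`
forces `φ ∈ EPiA n`.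

The class of such an element in the abelianization of `EPiA n` is the product of the `muClass i j ^
A i j`. Acting trivially modulo 4 makes each `A i j` even, and for `n ≥ 3` each `muClass i j`
squares to 1, so the class is trivial. -/

/-! ### Cancellation in free groups and palindromic length reduction -/

/-- Cancellation peels `V` off from the right, and can consume `y` only if `Z` begins with the whole
inverse of `y :: V`. -/
theorem prefix_toWord_mul_of_not_prefix {α : Type*} [DecidableEq α] (h : List (α × Bool))
    (y : α × Bool) (V Z : List (α × Bool)) (hV : IsReduced (h ++ y :: V)) (hZ : IsReduced Z)
    (hn : ¬ invRev (y :: V) <+: Z) :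
    h ++ [y] <+: (mk (h ++ y :: V) * mk Z).toWord := by
  induction V using List.reverseRecOn generalizing Z with
  | nil =>
    have hr : IsReduced ((h ++ [y]) ++ Z) := by
      refine List.isChain_append.2 ⟨hV, hZ, ?_⟩
      intro a ha b hb hab
      simp only [List.getLast?_append, List.getLast?_singleton, Option.some_or,
        Option.mem_def, Option.some.injEq] at ha
      subst ha
      obtain ⟨Z', rfl⟩ : ∃ Z', Z = b :: Z' := by
        cases Z with
        | nil => simp at hb
        | cons c Z' => simp at hb; subst hb; exact ⟨_, rfl⟩
      by_contra hne
      apply hn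
      have : b = (y.1, !y.2) := by
        ext
        · exact hab.symm
        · simp; revert hne; cases y.2 <;> cases b.2 <;> simp
      subst this
      simp [invRev]
    rw [mul_mk, toWord_mk, hr.reduce_eq]
    exact List.prefix_append _ _
  | append_singleton V v ih =>
    have hV' : IsReduced (h ++ y :: V) := by
      have : h ++ y :: (V ++ [v]) = (h ++ y :: V) ++ [v] := by simp
      rw [this] at hV
      exact (List.isChain_append.1 hV).1
    by_cases hc : ∃ Z', Z = (v.1, !v.2) :: Z'
    · obtain ⟨Z', rfl⟩ := hc
      have e : (mk (h ++ y :: (V ++ [v])) * mk ((v.1, !v.2) :: Z') : FreeGroup α)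
          = mk (h ++ y :: V) * mk Z' := by
        have h1 : (mk (h ++ y :: (V ++ [v])) : FreeGroup α) = mk (h ++ y :: V) * mk [v] := by
          simp [mul_mk]
        have h2 : (mk ((v.1, !v.2) :: Z') : FreeGroup α) = (mk [v])⁻¹ * mk Z' := by
          simp [mul_mk, inv_mk, invRev]
        rw [h1, h2]; group
      rw [e]
      refine ih Z' hV' hZ.tail ?_
      intro hp
      apply hn
      have : invRev (y :: (V ++ [v])) = (v.1, !v.2) :: invRev (y :: V) := by
        simp [invRev]
      rw [this]
      exact (List.prefix_cons_inj _).2 hp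
    · have hr : IsReduced ((h ++ y :: (V ++ [v])) ++ Z) := by
        refine List.isChain_append.2 ⟨hV, hZ, ?_⟩
        intro a ha b hb hab
        have ha' : v = a := by
          rw [← List.cons_append, ← List.append_assoc, List.getLast?_append] at ha
          simpa using ha
        subst ha'
        by_contra hne
        apply hc
        cases Z with
        | nil => simp at hb
        | cons c Z' =>
          simp at hb
          subst hb
          refine ⟨Z', ?_⟩
          congr 1
          ext
          · exact hab.symm
          · simp; revert hne; cases v.2 <;> cases c.2 <;> simp
      rw [mul_mk, toWord_mk, hr.reduce_eq]
      exact ⟨V ++ [v] ++ Z, by simp⟩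

theorem _root_.List.Palindrome.exists_eq_append_reverse {α : Type*} {l : List α}
    (h : l.Palindrome) :
    (∃ u, l = u ++ u.reverse) ∨ ∃ u y, l = u ++ y :: u.reverse := by
  induction h with
  | nil => exact Or.inl ⟨[], rfl⟩
  | singleton x => exact Or.inr ⟨[], x, rfl⟩
  | cons_concat x _ ih =>
    rcases ih with ⟨u, rfl⟩ | ⟨u, y, rfl⟩
    · exact Or.inl ⟨x :: u, by simp⟩
    · exact Or.inr ⟨x :: u, y, by simp⟩

theorem isPalindrome_apply_letter {n : ℕ} {φ : MulAut (F n)} (hφ : φ ∈ PiA n)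
    (a : Fin n × Bool) : IsPalindrome (φ (mk [a])) := by
  rw [isPalindrome_iff_rev, ← map_rev φ hφ, rev_mk]
  rfl

theorem parity_rev {n : ℕ} (f : F n →* Multiplicative (ZMod 2)) (u : F n) : f (rev u) = f u := by
  have h2 : ∀ x : Multiplicative (ZMod 2), x⁻¹ = x := by decide
  have : f.comp (invGens n) = f := by
    ext i
    simp [invGens, h2]
  rw [rev, map_inv, h2]
  exact DFunLike.congr_fun this u

/-- The image of a letter under a palindromic automorphism has odd length. -/
theorem exists_toWord_apply_letter {n : ℕ} {φ : MulAut (F n)} (hφ : φ ∈ PiA n)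
    (a : Fin n × Bool) : ∃ u y, (φ (mk [a])).toWord = u ++ y :: u.reverse := by
  rcases (List.Palindrome.of_reverse_eq
    (isPalindrome_apply_letter hφ a)).exists_eq_append_reverse with ⟨u, hu⟩ | h
  · exfalso
    have h1 : φ (mk [a]) = mk u * rev (mk u) := by
      rw [rev_mk, mul_mk, ← hu, mk_toWord]
    -- Every mod 2 character kills `u * rev u`; applied to length parity composed with `φ⁻¹`, this
    -- would make a single letter even.
    let g : F n →* Multiplicative (ZMod 2) := FreeGroup.lift fun _ => Multiplicative.ofAdd 1
    have h2 : g (mk [a]) = 1 := by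
      have : (g.comp φ⁻¹.toMonoidHom) (φ (mk [a])) = g (mk [a]) := by
        simp
      rw [← this, h1, map_mul, parity_rev]
      have h3 : ∀ x : Multiplicative (ZMod 2), x * x = 1 := by decide
      exact h3 _
    obtain ⟨i, b⟩ := a
    revert h2
    cases b <;> simp [g, FreeGroup.lift_mk]
  · exact h

/-- If no elementary palindromic transformation shortens a palindromic automorphism, then its
inverse permutes the letters. -/
theorem exists_inv_apply_of_eq_letter {n : ℕ} {φ : MulAut (F n)} (hφ : φ ∈ PiA n)
    (hmin : ∀ i j, i ≠ j →
      (φ (of i)).norm ≤ (φ (of j) * φ (of i) * φ (of j)).norm ∧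
      (φ (of i)).norm ≤ ((φ (of j))⁻¹ * φ (of i) * (φ (of j))⁻¹).norm) (k : Fin n) :
    ∃ a : Fin n × Bool, φ⁻¹ (of k) = mk [a] := by
  choose U y hU using exists_toWord_apply_letter hφ
  have hW (a : Fin n × Bool) : φ (mk [a]) = mk (U a ++ y a :: (U a).reverse) := by
    rw [← hU, mk_toWord]
  have hinv (i : Fin n) : (mk [(i, false)] : F n) = (of i)⁻¹ := rfl
  have hof (i : Fin n) : (mk [(i, true)] : F n) = of i := rfl
  have hmin' (a b : Fin n × Bool) (hab : a.1 ≠ b.1) :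
      (φ (mk [b])).norm ≤ ((φ (mk [a]))⁻¹ * φ (mk [b]) * (φ (mk [a]))⁻¹).norm := by
    obtain ⟨j, s⟩ := a
    obtain ⟨i, t⟩ := b
    obtain ⟨h1, h2⟩ := hmin i j (Ne.symm hab)
    have e (x z : F n) : (x * z⁻¹ * x).norm = (x⁻¹ * z * x⁻¹).norm := by
      rw [← norm_inv_eq]; congr 1; group
    cases s <;> cases t <;> simp only [hinv, hof, map_inv, inv_inv, norm_inv_eq, e]
    · exact h2
    · exact h1
    · exact h1
    · exact h2
  have hlen (a : Fin n × Bool) : (φ (mk [a])).norm = 2 * (U a).length + 1 := by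
    rw [FreeGroup.norm, hU]; simp; ring
  -- Equal halves would contradict injectivity. If `U b = U a ++ y a :: v`, multiplying `φ b` by `(φ
  -- a)⁻¹` on both sides leaves length at most `2|U a| + 2|v| + 1 = 2|U b| - 1`, against minimality.
  have hincomp (a b : Fin n × Bool) (hab : a ≠ b) : ¬ U a ++ [y a] <+: U b ++ [y b] := by
    rintro ⟨t, ht⟩
    rcases List.eq_nil_or_concat t with rfl | ⟨v, z, rfl⟩
    · rw [List.append_nil] at ht
      obtain ⟨h1, h2⟩ := List.append_inj' ht rfl
      have h3 : φ (mk [a]) = φ (mk [b]) := by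
        rw [hW, hW, h1, (List.cons.inj h2).1]
      have h4 := congrArg toWord (φ.injective h3)
      simp at h4
      exact hab h4
    · rw [List.concat_eq_append, ← List.append_assoc] at ht
      obtain ⟨h1, h2⟩ := List.append_inj' ht rfl
      have h3 := (List.cons.inj h2).1
      have hl : (U a).length + 1 + v.length = (U b).length := by rw [← h1]; simp; ring
      have hne : a.1 ≠ b.1 := by
        intro h
        have : (φ (mk [a])).norm = (φ (mk [b])).norm := by
          obtain ⟨j, s⟩ := a
          obtain ⟨i, t⟩ := b
          simp only at h
          subst h
          cases s <;> cases t <;> simp [hinv, hof]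
        rw [hlen, hlen] at this
        omega
      have := hmin' a b hne
      have e1 : φ (mk [b]) = mk (U a ++ [y a]) * mk (v ++ y b :: v.reverse)
          * rev (mk (U a ++ [y a])) := by
        rw [hW, rev_mk, mul_mk, mul_mk, ← h1]
        simp
      have e2 : φ (mk [a]) = mk (U a ++ [y a]) * mk (U a).reverse := by
        rw [hW, mul_mk]; simp
      have e3 : φ (mk [a]) = mk (U a) * rev (mk (U a ++ [y a])) := by
        rw [hW, rev_mk, mul_mk]; simp
      have e4 : (φ (mk [a]))⁻¹ * φ (mk [b]) * (φ (mk [a]))⁻¹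
          = (mk (U a).reverse)⁻¹ * mk (v ++ y b :: v.reverse) * (mk (U a))⁻¹ := by
        nth_rewrite 1 [e2]
        rw [e3, e1]
        group
      have b1 := norm_mul_le ((mk (U a).reverse)⁻¹ * mk (v ++ y b :: v.reverse)) (mk (U a))⁻¹
      have b2 := norm_mul_le (mk (U a).reverse)⁻¹ (mk (v ++ y b :: v.reverse))
      have b3 := norm_mk_le (L₁ := U a)
      have b4 := norm_mk_le (L₁ := (U a).reverse)
      have b5 := norm_mk_le (L₁ := v ++ y b :: v.reverse)
      rw [e4, hlen] at this
      simp only [norm_inv_eq] at b1 b2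
      simp at b4 b5
      omega
  have hflip (a : Fin n × Bool) :
      invRev (y a :: (U a).reverse) = U (a.1, !a.2) ++ [y (a.1, !a.2)] := by
    have h1 : φ (mk [(a.1, !a.2)]) = (φ (mk [a]))⁻¹ := by
      rw [← map_inv, inv_mk]; rfl
    have h2 := congrArg toWord h1
    rw [toWord_inv, hU, hU] at h2
    have h3 : (U (a.1, !a.2)).length = (U a).length := by
      have := congrArg List.length h2
      simp at this
      omega
    have h4 : (U (a.1, !a.2) ++ [y (a.1, !a.2)]) ++ (U (a.1, !a.2)).reverse
        = invRev (y a :: (U a).reverse) ++ invRev (U a) := by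
      rw [← invRev_append, ← h2]; simp
    exact (List.append_inj h4 (by simp [h3])).1.symm
  -- By `hflip`, cancelling the middle letter of `φ a` would make the halves of `a⁻¹` and of the
  -- next letter comparable.
  have hpre (a : Fin n × Bool) (L : List (Fin n × Bool)) (hL : IsReduced (a :: L)) :
      U a ++ [y a] <+: (φ (mk (a :: L))).toWord := by
    induction L generalizing a with
    | nil => rw [hU]; exact ⟨(U a).reverse, by simp⟩
    | cons b L ih =>
      have h1 : φ (mk (a :: b :: L))
          = mk (U a ++ y a :: (U a).reverse) * mk (φ (mk (b :: L))).toWord := by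
        rw [mk_toWord, ← hW, ← map_mul, mul_mk]; rfl
      rw [h1]
      apply prefix_toWord_mul_of_not_prefix
      · rw [← hU]; exact isReduced_toWord
      · exact isReduced_toWord
      · rw [hflip]
        intro hp
        have hne : (a.1, !a.2) ≠ b := by
          rintro rfl
          have := (List.isChain_cons_cons.1 hL).1 rfl
          simp at this
        rcases List.prefix_or_prefix_of_prefix hp (ih b hL.tail) with h | h
        · exact hincomp _ _ hne h
        · exact hincomp _ _ hne.symm h
  obtain ⟨L, hL⟩ : ∃ L, (φ⁻¹ (of k)).toWord = L := ⟨_, rfl⟩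
  have hmk : φ⁻¹ (of k) = mk L := by rw [← hL, mk_toWord]
  have hφL : φ (mk L) = of k := by rw [← hmk]; simp
  cases L with
  | nil =>
    have : (of k : F n) = 1 := by rw [← hφL]; exact map_one φ
    exact absurd this (of_ne_one k)
  | cons a L =>
    refine ⟨a, ?_⟩
    have hp := hpre a L (by rw [← hL]; exact isReduced_toWord)
    rw [hφL, toWord_of] at hp
    have h1 : U a = [] := by
      have := hp.length_le
      simp at this
      exact this
    rw [h1] at hp
    have h2 : y a = (k, true) := by simpa using hp
    have : φ (mk [a]) = of k := by rw [hW, h1, h2]; rfl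
    rw [← this]; simp

theorem mu_apply_of {n : ℕ} {i j : Fin n} (h : i ≠ j) (k : Fin n) :
    mu i j h (of k) = if k = i then of j * of i * of j else of k := by
  simp [mu, muHom]

theorem mu_inv_apply_of {n : ℕ} {i j : Fin n} (h : i ≠ j) (k : Fin n) :
    (mu i j h)⁻¹ (of k) = if k = i then (of j)⁻¹ * of i * (of j)⁻¹ else of k := by
  change muHom i (of j)⁻¹ (of k) = _
  simp [muHom]

theorem mu_mem_EPiA {n : ℕ} {i j : Fin n} (h : i ≠ j) : mu i j h ∈ EPiA n :=
  Subgroup.subset_closure ⟨i, j, h, rfl⟩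

theorem EPiA_le_PiA (n : ℕ) : EPiA n ≤ PiA n := by
  refine (Subgroup.closure_le _).2 ?_
  rintro _ ⟨i, j, h, rfl⟩ k
  rw [isPalindrome_iff_rev, mu_apply_of]
  split_ifs <;> simp [rev_mul, rev_of, mul_assoc]

/-- Every palindromic automorphism is, up to an elementary palindromic one, a signed
permutation of the basis. -/
theorem exists_mul_inv_apply_of_eq_letter {n : ℕ} {φ : MulAut (F n)} (hφ : φ ∈ PiA n) :
    ∃ e ∈ EPiA n, ∀ k, ∃ a : Fin n × Bool, (φ * e)⁻¹ (of k) = mk [a] := by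
  induction hN : ∑ i, (φ (of i)).norm using Nat.strong_induction_on generalizing φ with
  | _ N ih =>
    subst hN
    by_cases hmin : ∀ i j, i ≠ j →
      (φ (of i)).norm ≤ (φ (of j) * φ (of i) * φ (of j)).norm ∧
      (φ (of i)).norm ≤ ((φ (of j))⁻¹ * φ (of i) * (φ (of j))⁻¹).norm
    · exact ⟨1, one_mem _, by simpa using exists_inv_apply_of_eq_letter hφ hmin⟩
    · obtain ⟨i, m, hm, hi, hlt⟩ : ∃ (i : Fin n) (m : MulAut (F n)), m ∈ EPiA n ∧
          (∀ k, k ≠ i → m (of k) = of k) ∧ (φ (m (of i))).norm < (φ (of i)).norm := by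
        push Not at hmin
        obtain ⟨i, j, hij, h⟩ := hmin
        by_cases h1 : (φ (of i)).norm ≤ (φ (of j) * φ (of i) * φ (of j)).norm
        · refine ⟨i, (mu i j hij)⁻¹, inv_mem (mu_mem_EPiA hij), fun k hk => ?_, ?_⟩
          · rw [mu_inv_apply_of, if_neg hk]
          · rw [mu_inv_apply_of, if_pos rfl]
            simpa using h h1
        · refine ⟨i, mu i j hij, mu_mem_EPiA hij, fun k hk => ?_, ?_⟩
          · rw [mu_apply_of, if_neg hk]
          · rw [mu_apply_of, if_pos rfl]
            simpa using h1
      have hsum : ∑ k, ((φ * m) (of k)).norm < ∑ k, (φ (of k)).norm := by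
        refine Finset.sum_lt_sum (fun k _ => ?_) ⟨i, Finset.mem_univ _, hlt⟩
        by_cases hk : k = i
        · subst hk; exact hlt.le
        · rw [MulAut.mul_apply, hi k hk]
      obtain ⟨e, he, h⟩ := ih _ hsum (mul_mem hφ (EPiA_le_PiA n hm)) rfl
      exact ⟨m * e, mul_mem hm he, by simpa [mul_assoc] using h⟩

/-! ### Exponent sums modulo 4 and the abelianization of `EPiA n` -/

/-- The exponent sum modulo `4` of the basis element `x_k`. -/
def expSum {n : ℕ} (k : Fin n) : F n →* Multiplicative (ZMod 4) :=
  FreeGroup.lift fun i => Multiplicative.ofAdd (if i = k then 1 else 0)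

theorem toAdd_expSum_of {n : ℕ} (k i : Fin n) :
    (expSum k (of i)).toAdd = if i = k then 1 else 0 := by
  simp [expSum]

theorem IA_apply {n : ℕ} {φ : MulAut (F n)} (hφ : φ ∈ IA n) {A : Type*} [CommGroup A]
    (f : F n →* A) (w : F n) : f (φ w) = f w := by
  have h : abMap (F n) φ (Abelianization.of w) = Abelianization.of w := by
    rw [MonoidHom.mem_ker.1 hφ]; rfl
  have h1 : Abelianization.of (φ w) = Abelianization.of w := h
  rw [← Abelianization.lift_apply_of f, h1, Abelianization.lift_apply_of]

/-- The class of `μ_{ij}` in the abelianization of `EΠA_n`, trivial for `i = j`. -/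
def muClass {n : ℕ} (i j : Fin n) : Abelianization (EPiA n) :=
  if h : i ≠ j then Abelianization.of ⟨mu i j h, mu_mem_EPiA h⟩ else 1

/-- In the abelianization the other two factors cancel, leaving the square of the class of `mu i j
hij`; the third index is where `n ≥ 3` enters. -/
theorem mu_conj {n : ℕ} {i j k : Fin n} (hij : i ≠ j) (hik : i ≠ k) (hkj : k ≠ j) :
    mu k j hkj * mu i k hik = mu i j hij * mu i k hik * mu i j hij * mu k j hkj := by
  apply MulEquiv.toMonoidHom_injective
  ext l
  by_cases hl : l = i
  · subst hl
    simp [mu_apply_of, hik, hik.symm, hij.symm, mul_assoc]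
  · by_cases hl' : l = k
    · subst hl'
      simp [mu_apply_of, hik.symm, hij.symm, mul_assoc]
    · simp [mu_apply_of, hl, hl']

theorem muClass_mul_self {n : ℕ} (hn : 3 ≤ n) (i j : Fin n) :
    muClass i j * muClass i j = 1 := by
  by_cases hij : i ≠ j
  · obtain ⟨k, hk⟩ : ∃ k, k ∉ ({i, j} : Finset (Fin n)) := by
      by_contra! h
      have h1 : (Finset.univ : Finset (Fin n)) ⊆ {i, j} := fun k _ => h k
      have h2 := Finset.card_le_card h1
      have h3 := Finset.card_le_two (a := i) (b := j)
      simp only [Finset.card_univ, Fintype.card_fin] at h2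
      omega
    simp only [Finset.mem_insert, Finset.mem_singleton, not_or] at hk
    have hik : i ≠ k := Ne.symm hk.1
    have h : (⟨mu k j hk.2, mu_mem_EPiA hk.2⟩ * ⟨mu i k hik, mu_mem_EPiA hik⟩ : EPiA n)
        = ⟨mu i j hij, mu_mem_EPiA hij⟩ * ⟨mu i k hik, mu_mem_EPiA hik⟩
          * ⟨mu i j hij, mu_mem_EPiA hij⟩ * ⟨mu k j hk.2, mu_mem_EPiA hk.2⟩ :=
      Subtype.ext (mu_conj hij hik hk.2)
    have h' := congrArg Abelianization.of h
    simp only [map_mul] at h'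
    simp only [muClass, dif_pos hij]
    generalize (Abelianization.of (⟨mu i j hij, mu_mem_EPiA hij⟩ : EPiA n)) = a at *
    generalize (Abelianization.of (⟨mu k j hk.2, mu_mem_EPiA hk.2⟩ : EPiA n)) = b at *
    generalize (Abelianization.of (⟨mu i k hik, mu_mem_EPiA hik⟩ : EPiA n)) = c at *
    have e : a * c * a * b = (a * a) * (b * c) := by
      rw [mul_right_comm a c a, mul_assoc, mul_comm c b]
    rw [e] at h'
    exact (mul_eq_right.1 h'.symm)
  · simp [muClass, hij]

/-- An elementary palindromic automorphism acts modulo `4` as `1 + 2A`, where `A` has zero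
diagonal and records its class in the abelianization of `EΠA_n`. -/
theorem exists_exponent_matrix {n : ℕ} {e : MulAut (F n)} (he : e ∈ EPiA n) :
    ∃ A : Fin n → Fin n → ℤ, (∀ i, A i i = 0) ∧
      (∀ i k, (expSum k (e (of i))).toAdd = (if i = k then 1 else 0) + 2 * (A i k : ZMod 4)) ∧
      Abelianization.of (⟨e, he⟩ : EPiA n) = ∏ p : Fin n × Fin n, muClass p.1 p.2 ^ A p.1 p.2 := by
  have four (x : ZMod 4) : 2 * (2 * x) = 0 := by revert x; decide
  have key (x : MulAut (F n)) (hx : x ∈ EPiA n) (m : MulAut (F n)) (hm : m ∈ EPiA n)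
      (i j : Fin n) (hij : i ≠ j) (s : ℤ) (hmi : m (of i) = of j ^ s * of i * of j ^ s)
      (hmk : ∀ k, k ≠ i → m (of k) = of k)
      (hc : Abelianization.of (⟨m, hm⟩ : EPiA n) = muClass i j ^ s)
      (ih : ∃ A : Fin n → Fin n → ℤ, (∀ i, A i i = 0) ∧
        (∀ i k, (expSum k (x (of i))).toAdd = (if i = k then 1 else 0) + 2 * (A i k : ZMod 4)) ∧
        Abelianization.of (⟨x, hx⟩ : EPiA n)
          = ∏ p : Fin n × Fin n, muClass p.1 p.2 ^ A p.1 p.2) :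
      ∃ A : Fin n → Fin n → ℤ, (∀ i, A i i = 0) ∧
        (∀ i k, (expSum k ((x * m) (of i))).toAdd
          = (if i = k then 1 else 0) + 2 * (A i k : ZMod 4)) ∧
        Abelianization.of (⟨x * m, mul_mem hx hm⟩ : EPiA n)
          = ∏ p : Fin n × Fin n, muClass p.1 p.2 ^ A p.1 p.2 := by
    obtain ⟨A, hA, hM, hP⟩ := ih
    refine ⟨fun a b => A a b + if (a, b) = (i, j) then s else 0, fun a => ?_, fun a k => ?_, ?_⟩
    · beta_reduce
      rw [hA, if_neg, add_zero]
      intro h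
      exact hij ((Prod.mk.inj h).1.symm.trans (Prod.mk.inj h).2)
    · rw [MulAut.mul_apply]
      by_cases ha : a = i
      · subst ha
        rw [hmi]
        simp only [map_mul, map_zpow, toAdd_mul, toAdd_zpow, hM, zsmul_eq_mul, Prod.mk.injEq,
          true_and, eq_comm (a := j)]
        -- The cross term of `(1 + 2A)(1 + 2B)` vanishes modulo 4, so `A` is additive.
        have := four (s * A j k)
        push_cast
        split_ifs <;> linear_combination this
      · rw [hmk a ha, hM]
        simp [ha]
    · have : (⟨x * m, mul_mem hx hm⟩ : EPiA n) = ⟨x, hx⟩ * ⟨m, hm⟩ := rfl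
      rw [this, map_mul, hP, hc]
      simp only [zpow_add, Finset.prod_mul_distrib]
      congr 1
      rw [Finset.prod_eq_single (i, j)]
      · simp
      · rintro p - hp
        rw [if_neg hp, zpow_zero]
      · simp
  induction he using Subgroup.closure_induction_right with
  | one =>
    refine ⟨0, fun _ => rfl, fun i k => ?_, ?_⟩
    · simp [toAdd_expSum_of]
    · simp only [Pi.zero_apply, zpow_zero, Finset.prod_const_one]
      exact map_one (Abelianization.of (G := EPiA n))
  | mul_right x hx m hm ih =>
    obtain ⟨i, j, hij, rfl⟩ := hm
    refine key x hx _ (mu_mem_EPiA hij) i j hij 1 ?_ (fun k hk => ?_) ?_ ih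
    · simp [mu_apply_of]
    · simp [mu_apply_of, hk]
    · simp [muClass, hij]
  | mul_inv_cancel x hx m hm ih =>
    obtain ⟨i, j, hij, rfl⟩ := hm
    refine key x hx _ (inv_mem (mu_mem_EPiA hij)) i j hij (-1) ?_ (fun k hk => ?_) ?_ ih
    · rw [mu_inv_apply_of, if_pos rfl, zpow_neg_one]
    · rw [mu_inv_apply_of, if_neg hk]
    · simp only [muClass, dif_pos hij, zpow_neg, zpow_one, ← map_inv]
      rfl

theorem PI_le_EPiA (n : ℕ) : PI n ≤ EPiA n := by
  rintro φ ⟨hIA, hPi⟩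
  obtain ⟨e, he, h⟩ := exists_mul_inv_apply_of_eq_letter hPi
  obtain ⟨A, hA, hM, -⟩ := exists_exponent_matrix (inv_mem he)
  have hs : (φ * e)⁻¹ = 1 := by
    apply MulEquiv.toMonoidHom_injective
    ext k
    obtain ⟨⟨p, s⟩, hp⟩ := h k
    -- The factor `φ⁻¹` of `(φ * e)⁻¹ = e⁻¹ * φ⁻¹` is invisible to characters.
    have hf (l : Fin n) : (expSum l (mk [(p, s)] : F n)).toAdd
        = (if k = l then 1 else 0) + 2 * (A k l : ZMod 4) := by
      rw [← hM, ← hp, mul_inv_rev, MulAut.mul_apply]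
      exact congrArg Multiplicative.toAdd
        (IA_apply (inv_mem hIA) ((expSum l).comp (e⁻¹).toMonoidHom) (of k))
    -- Parity fixes the permutation; the diagonal entry 1, distinct from -1 modulo 4, fixes the
    -- sign.
    have h0 : ∀ x : ZMod 4, 1 ≠ 2 * x ∧ -1 ≠ 2 * x := by decide
    have hneg : (mk [(p, false)] : F n) = (of p)⁻¹ := rfl
    have hpos : (mk [(p, true)] : F n) = of p := rfl
    have hkp : k = p := by
      by_contra hne
      have h1 := hf p
      rw [if_neg hne, zero_add] at h1
      cases s
      · rw [hneg, map_inv, toAdd_inv, toAdd_expSum_of, if_pos rfl] at h1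
        exact (h0 _).2 h1
      · rw [hpos, toAdd_expSum_of, if_pos rfl] at h1
        exact (h0 _).1 h1
    subst hkp
    have h1 := hf k
    rw [if_pos rfl, hA, Int.cast_zero, mul_zero, add_zero] at h1
    cases s
    · rw [hneg, map_inv, toAdd_inv, toAdd_expSum_of, if_pos rfl] at h1
      exact absurd h1 (by decide)
    · exact hp
  have : φ = e⁻¹ := eq_inv_of_mul_eq_one_left (inv_eq_one.1 hs)
  rw [this]
  exact inv_mem he

theorem EPiA_inf_IA_le_commutator {n : ℕ} (hn : 3 ≤ n) :
    EPiA n ⊓ IA n ≤ ⁅EPiA n, EPiA n⁆ := by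
  rintro e ⟨he, hIA⟩
  obtain ⟨A, -, hM, hP⟩ := exists_exponent_matrix he
  have hone : Abelianization.of (⟨e, he⟩ : EPiA n) = 1 := by
    rw [hP]
    refine Finset.prod_eq_one fun p _ => ?_
    have h1 := hM p.1 p.2
    rw [IA_apply hIA, toAdd_expSum_of, left_eq_add] at h1
    have h2 : ((2 * A p.1 p.2 : ℤ) : ZMod 4) = 0 := by push_cast; exact h1
    rw [ZMod.intCast_zmod_eq_zero_iff_dvd] at h2
    obtain ⟨c, hc⟩ : (2 : ℤ) ∣ A p.1 p.2 := by
      push_cast at h2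
      omega
    rw [hc, zpow_mul, zpow_two, muClass_mul_self hn, one_zpow]
  have hmem : (⟨e, he⟩ : EPiA n) ∈ commutator (EPiA n) := by
    rw [← Abelianization.ker_of]
    exact hone
  rw [← Subgroup.map_subtype_commutator]
  exact ⟨_, hmem, rfl⟩

end PalindromicAut

theorem theorem6p1 (n : ℕ) (hn : 3 ≤ n) :
    PalindromicAut.PI n =
      PalindromicAut.IA n ⊓ ⁅PalindromicAut.EPiA n, PalindromicAut.EPiA n⁆ := by
  apply le_antisymm
  · intro φ hφ
    exact ⟨hφ.1, PalindromicAut.EPiA_inf_IA_le_commutator hn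
      ⟨PalindromicAut.PI_le_EPiA n hφ, hφ.1⟩⟩
  · rintro φ ⟨hIA, hc⟩
    exact ⟨hIA, PalindromicAut.EPiA_le_PiA n (Subgroup.commutator_le_self _ hc)⟩
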